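/- Let $R$ be a Noetherian local ring with maximal ideal $\mathfrak m$, residue field $k=R/\mathfrak m$ and total ring of fractions $Q$. Let $e>0$, let $G\cong R^e$ be a free $R$-module, and let $E\subseteq G$ be a submodule (hence finitely generated and torsionfree) of rank $e$, i.e. $E\otimes_R Q\cong Q^e$. Assume that $E$ is not free. For a finitely generated $R$-module $M$ having a rank, the Rees algebra $\mathcal R(M)$ is the quotient of the symmetric algebra $\mathcal S(M)$ by its $R$-torsion, and the analytic spread $\ell(M)$ is the Krull dimension of $\mathcal R(M)\otimes_R k$. The $i$-th Fitting ideal $F_i(M)$ is the ideal generated by the $(n-i)\times(n-i)$ minors of an $n\times m$ matrix $\varphi$ in a finite free presentation $R^m\xrightarrow{\varphi}R^n\to M\to 0$ (and $F_i(M)=R$ for $i\ge n$). Then $$\ell\Big(\bigwedge\nolimits^{e}E\Big)\ \ge\ \operatorname{ht}F_0(G/E).$$ If moreover $E$ is an ideal module, that is, $E$ admits an embedding into some free module $G'\cong R^n$ with $\operatorname{grade} G'/E\ge 2$ (for instance the given one, if $\operatorname{grade} G/E\geq 2$), then $$\ell\Big(\bigwedge\nolimits^{e}E\Big)\ \ge\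 \operatorname{ht}F_e(E).$$ Here the grade of a finitely generated module $M$ is the supremum of the lengths of the $R$-regular sequences contained in $\operatorname{Ann}_R M$ if $M\ne0$, and $\infty$ if $M=0$. -/

import Mathlib

open scoped TensorProduct

noncomputable section

namespace ModuleDivisors

universe u v

/-- The `R`-module `M` has rank `e`: if `Q` is the total ring of fractions of `R` (the localization
at all non-zero-divisors), then `Q ⊗ M ≅ Q ^ e`. -/
def HasRank (R : Type u) [CommRing R] (M : Type v) [AddCommGroup M] [Module R M] (e : ℕ) : Prop :=
  Nonempty ((FractionRing R ⊗[R] M) ≃ₗ[FractionRing R] (Fin e → FractionRing R))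

/-- The ideal generated by the `t × t` minors of a matrix. -/
def minorsIdeal {R : Type u} [CommRing R] {n m : ℕ} (A : Matrix (Fin n) (Fin m) R) (t : ℕ) :
    Ideal R :=
  Ideal.span {d : R | ∃ (r : Fin t ↪o Fin n) (c : Fin t ↪o Fin m), d = (A.submatrix r c).det}

/-- `R ^ m → R ^ n → M → 0` is exact, where the first map is multiplication by `A` and the second
one sends the standard basis vectors to the elements `x i`. -/
structure IsPresentation {R : Type u} [CommRing R] {M : Type v} [AddCommGroup M] [Module R M]
    {n m : ℕ} (A : Matrix (Fin n) (Fin m) R) (x : Fin n → M) : Prop where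
  span_eq_top : Submodule.span R (Set.range x) = ⊤
  range_eq_ker : LinearMap.range A.mulVecLin = LinearMap.ker (Fintype.linearCombination R x)

/-- The `i`-th Fitting ideal of a finitely presented module `M`: the ideal generated by the
`(n - i) × (n - i)` minors of an `n × m` presentation matrix of `M`. This ideal does not depend on
the finite presentation; to avoid a choice, the sum over all finite presentations is taken.
(For `i ≥ n` the `0 × 0` minor `1` gives the unit ideal.) -/
def fittingIdeal (R : Type u) [CommRing R] (M : Type v) [AddCommGroup M] [Module R M] (i : ℕ) :
    Ideal R :=
  ⨆ (n : ℕ) (m : ℕ) (A : Matrix (Fin n) (Fin m) R) (x : Fin n → M) (_ : IsPresentation A x),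
    minorsIdeal A (n - i)

/-- The grade of a finitely generated module `M` over a Noetherian ring `R`: the supremum of the
lengths of `R`-regular sequences in the annihilator of `M`. If `M ≠ 0`, weakly regular sequences in
the annihilator are regular; if `M = 0`, the grade is `∞`, since `1, 1, …, 1` is weakly regular. -/
def moduleGrade (R : Type u) [CommRing R] (M : Type v) [AddCommGroup M] [Module R M] : ℕ∞ :=
  ⨆ (rs : List R) (_ : (∀ r ∈ rs, r ∈ Module.annihilator R M) ∧
    RingTheory.Sequence.IsWeaklyRegular R rs), (rs.length : ℕ∞)

/-- `E` is an ideal module: it embeds in a free module `G = R ^ n` with `grade G / E ≥ 2`.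
(Over a Noetherian ring such a module is finitely generated and torsionfree, and it has
rank `n`.) -/
def IsIdealModule (R : Type u) [CommRing R] (E : Type v) [AddCommGroup E] [Module R E] : Prop :=
  ∃ (n : ℕ) (f : E →ₗ[R] (Fin n → R)), Function.Injective f ∧
    2 ≤ moduleGrade R ((Fin n → R) ⧸ LinearMap.range f)

/-- The `R`-torsion of an `R`-algebra `A` (the elements killed by some non-zero-divisor of `R`),
which is an ideal of `A`. -/
def torsionIdeal (R : Type u) [CommRing R] (A : Type v) [CommRing A] [Algebra R A] : Ideal A where
  carrier := (Submodule.torsion R A : Set A)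
  add_mem' := fun ha hb => (Submodule.torsion R A).add_mem ha hb
  zero_mem' := (Submodule.torsion R A).zero_mem
  smul_mem' := fun c x hx => by
    obtain ⟨a, ha⟩ := hx
    refine ⟨a, ?_⟩
    rw [smul_eq_mul, mul_comm, ← smul_mul_assoc, ha, zero_mul]

/-- The Rees algebra of a module: its symmetric algebra modulo `R`-torsion. -/
abbrev ReesAlg (R : Type u) [CommRing R] (M : Type v) [AddCommGroup M] [Module R M] :=
  SymmetricAlgebra R M ⧸ torsionIdeal R (SymmetricAlgebra R M)

/-- The fiber cone of a module over a local ring: the Rees algebra tensored with the residue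
field. -/
abbrev FiberCone (R : Type u) [CommRing R] [IsLocalRing R] (M : Type v) [AddCommGroup M]
    [Module R M] :=
  ReesAlg R M ⊗[R] IsLocalRing.ResidueField R

/-- The analytic spread of a module over a local ring: the Krull dimension of its fiber cone. -/
def analyticSpread (R : Type u) [CommRing R] [IsLocalRing R] (M : Type v) [AddCommGroup M]
    [Module R M] : WithBot ℕ∞ :=
  ringKrullDim (FiberCone R M)

end ModuleDivisors

end

/-! A linear form on a module `M` with image `I` maps the Rees algebra of `M` onto `R[It]`, since
`R[It] ⊆ R[t]` has no `R`-torsion. Hence the analytic spread of `M` is at least the dimension `l` of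
`R[It]/𝔪R[It]`. If `I` is proper, then `l ≥ ht I`: lift a homogeneous system of parameters of this
fiber; by Nakayama its `l` coefficients generate an ideal between some `Iⁿ` and `I`, and Krull's
height theorem applies (`height_le_ringKrullDim_reesAlgebra_quotient`).

Apply this to `M = ⋀ᵉE` and the determinant form of an embedding `E → Rᵉ`. Its image `I` is
generated by the determinants of `e`-tuples in `E`, and is proper because `E` is not free. It
remains to put the Fitting ideals inside the radical of `I`. An element `a` of `F₀(G/E)` satisfies
`aG ⊆ E`, so `aᵉ ∈ I`. For `Fₑ(E)`, a minor `a` multiplies `E` into a submodule with `e` generators;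
a regular sequence of length two in the annihilator of the cokernel then gives `a²ᵉ ∈ I`. -/

namespace ModuleDivisors
-- Homogeneous prime avoidance and systems of parameters
section Graded

variable {A σ : Type*} [CommRing A] [SetLike σ A] [AddSubmonoidClass σ A] (𝒜 : ℕ → σ)
  [GradedRing 𝒜]

open HomogeneousIdeal

/-- The homogeneous core of `p` is again prime and still contains `J`, so minimality forces it to
equal `p`. -/
theorem isHomogeneous_of_mem_minimalPrimes {J p : Ideal A} (hJ : J.IsHomogeneous 𝒜)
    (hp : p ∈ J.minimalPrimes) : p.IsHomogeneous 𝒜 := by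
  rw [Ideal.IsHomogeneous.iff_eq]
  refine le_antisymm (Ideal.toIdeal_homogeneousCore_le 𝒜 p) (hp.2 ⟨?_, ?_⟩ ?_)
  · exact hp.1.1.homogeneousCore
  · exact hJ.toIdeal_homogeneousCore_eq_self.symm.trans_le (Ideal.homogeneousCore_mono _ hp.1.2)
  · exact Ideal.toIdeal_homogeneousCore_le 𝒜 p

theorem exists_homogeneous_mem_notMem {p q : Ideal A} (hq : q.IsHomogeneous 𝒜) (h : ¬ q ≤ p) :
    ∃ (i : ℕ) (x : A), x ∈ 𝒜 i ∧ x ∈ q ∧ x ∉ p := by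
  classical
  by_contra! H
  refine h fun x hx => ?_
  rw [← DirectSum.sum_support_decompose 𝒜 x]
  exact Ideal.sum_mem _ fun i _ => H i _ (SetLike.coe_mem _) (hq i hx)

theorem exists_pos_degree_notMem {p : Ideal A} (h : ¬ (irrelevant 𝒜).toIdeal ≤ p) :
    ∃ (i : ℕ) (x : A), 0 < i ∧ x ∈ 𝒜 i ∧ x ∉ p := by
  by_contra! H
  refine h ((toIdeal_irrelevant_le 𝒜).2 fun i hi x hx => H i x hi hx)

theorem exists_homogeneous_mem_others (p : Ideal A) (hp : p.IsPrime)
    (h : ¬ (irrelevant 𝒜).toIdeal ≤ p) (S : Finset (Ideal A))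
    (hS : ∀ q ∈ S, q.IsHomogeneous 𝒜 ∧ ¬ q ≤ p) :
    ∃ (i : ℕ) (x : A), 0 < i ∧ x ∈ 𝒜 i ∧ x ∉ p ∧ ∀ q ∈ S, x ∈ q := by
  classical
  induction S using Finset.induction_on with
  | empty => simpa using exists_pos_degree_notMem 𝒜 h
  | insert q S _ ih =>
    obtain ⟨i, x, hi, hx, hxp, hxS⟩ := ih fun q hq => hS q (Finset.mem_insert_of_mem hq)
    obtain ⟨hq, hqp⟩ := hS q (Finset.mem_insert_self _ _)
    obtain ⟨j, y, hy, hyq, hyp⟩ := exists_homogeneous_mem_notMem 𝒜 hq hqp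
    refine ⟨i + j, x * y, by omega, SetLike.mul_mem_graded hx hy,
      fun hm => (hp.mem_or_mem hm).elim hxp hyp, fun r hr => ?_⟩
    rcases Finset.mem_insert.1 hr with rfl | hr
    · exact Ideal.mul_mem_left _ _ hyq
    · exact Ideal.mul_mem_right _ _ (hxS r hr)

/-- Homogeneous prime avoidance, for pairwise incomparable primes. -/
theorem exists_homogeneous_notMem (S : Finset (Ideal A))
    (hS : ∀ q ∈ S, q.IsPrime ∧ q.IsHomogeneous 𝒜 ∧ ¬ (irrelevant 𝒜).toIdeal ≤ q)
    (hinc : ∀ p ∈ S, ∀ q ∈ S, q ≤ p → q = p) :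
    ∃ (d : ℕ) (a : A), 0 < d ∧ a ∈ 𝒜 d ∧ ∀ q ∈ S, a ∉ q := by
  classical
  have key : ∀ p : S, ∃ (i : ℕ) (x : A), 0 < i ∧ x ∈ 𝒜 i ∧ x ∉ p.1 ∧ ∀ q ∈ S.erase p.1, x ∈ q :=
    fun p => exists_homogeneous_mem_others 𝒜 p.1 (hS _ p.2).1 (hS _ p.2).2.2 _ fun q hq =>
      ⟨(hS q (Finset.mem_of_mem_erase hq)).2.1, fun h =>
        (Finset.ne_of_mem_erase hq) (hinc _ p.2 _ (Finset.mem_of_mem_erase hq) h)⟩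
  choose e c he hc hcp hcq using key
  have hD : 0 < ∏ p, e p := Finset.prod_pos fun p _ => he p
  have hdvd : ∀ p, e p ∣ ∏ p, e p := fun p => Finset.dvd_prod_of_mem _ (Finset.mem_univ p)
  -- Powers bring all `c p` to one common degree; modulo a given `q` only the summand of `q` itself
  -- survives.
  refine ⟨∏ p, e p, ∑ p, c p ^ ((∏ p, e p) / e p), hD, sum_mem fun p _ => ?_, fun q hq hmem => ?_⟩
  · have := SetLike.pow_mem_graded ((∏ p, e p) / e p) (hc p)
    rwa [smul_eq_mul, Nat.div_mul_cancel (hdvd p)] at this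
  · rw [← Finset.add_sum_erase _ _ (Finset.mem_univ (⟨q, hq⟩ : S))] at hmem
    have h2 : ∑ p ∈ Finset.univ.erase (⟨q, hq⟩ : S), c p ^ ((∏ p, e p) / e p) ∈ q := by
      refine Ideal.sum_mem _ fun p hp => Ideal.pow_mem_of_mem _ (hcq p q ?_) _
        (Nat.div_pos (Nat.le_of_dvd hD (hdvd p)) (he p))
      refine Finset.mem_erase.2 ⟨fun h => Finset.ne_of_mem_erase hp (Subtype.ext h.symm), hq⟩
    exact hcp ⟨q, hq⟩ ((hS q hq).1.mem_of_pow_mem _ ((Ideal.add_mem_iff_left _ h2).1 hmem))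

/-- If `p` and the irrelevant ideal generated everything, the degree-zero part of an expression for
`1` would put `1` in `p`. This supplies the extra step in a chain of primes that bounds the
dimension below. -/
theorem exists_isPrime_gt {p : Ideal A} (hp : p.IsPrime) (hph : p.IsHomogeneous 𝒜)
    (h : ¬ (irrelevant 𝒜).toIdeal ≤ p) : ∃ q : Ideal A, q.IsPrime ∧ p < q := by
  have hne : p ⊔ (irrelevant 𝒜).toIdeal ≠ ⊤ := by
    intro htop
    obtain ⟨x, hx, y, hy, hxy⟩ := Submodule.mem_sup.1 ((Ideal.eq_top_iff_one _).1 htop)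
    refine hp.ne_top ((Ideal.eq_top_iff_one _).2 ?_)
    have h0 := congrArg (GradedRing.proj 𝒜 0) hxy
    have hy0 : GradedRing.proj 𝒜 0 y = 0 := (mem_irrelevant_iff 𝒜 y).1 hy
    have h10 : GradedRing.proj 𝒜 0 (1 : A) = 1 := by
      rw [GradedRing.proj_apply]
      exact DirectSum.decompose_of_mem_same 𝒜 SetLike.GradedOne.one_mem
    rw [map_add, hy0, add_zero, h10] at h0
    rw [← h0]
    exact hph 0 hx
  obtain ⟨q, hq, hle⟩ := Ideal.exists_le_maximal _ hne
  exact ⟨q, hq.isPrime, lt_of_le_of_ne (le_sup_left.trans hle) fun heq =>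
    h (heq ▸ le_sup_right.trans hle)⟩

/-- Each new element avoids the finitely many minimal primes over `J` and the earlier elements, so
passing to a prime containing it raises the height. Primes above the irrelevant ideal cannot be
avoided in positive degree and are exempted. Height is taken inside the zero locus of `J`, to match
the dimension of `A ⧸ J`. -/
theorem exists_homogeneous_sequence_height [IsNoetherianRing A] {J : Ideal A}
    (hJ : J.IsHomogeneous 𝒜) (i : ℕ) :
    ∃ a : Fin i → A, (∀ j, ∃ d, 0 < d ∧ a j ∈ 𝒜 d) ∧
      ∀ p : PrimeSpectrum.zeroLocus (J : Set A), Ideal.span (Set.range a) ≤ p.1.asIdeal →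
        ¬ (irrelevant 𝒜).toIdeal ≤ p.1.asIdeal → (i : ℕ∞) ≤ Order.height p := by
  classical
  induction i with
  | zero => exact ⟨Fin.elim0, fun j => j.elim0, fun p _ _ => by simp⟩
  | succ i ih =>
    obtain ⟨a, ha, hp⟩ := ih
    have hJa : (J ⊔ Ideal.span (Set.range a)).IsHomogeneous 𝒜 := by
      refine hJ.sup (Ideal.homogeneous_span 𝒜 _ ?_)
      rintro _ ⟨j, rfl⟩
      obtain ⟨d, -, hd⟩ := ha j
      exact ⟨d, hd⟩
    have hfin := (J ⊔ Ideal.span (Set.range a)).finite_minimalPrimes_of_isNoetherianRing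
    obtain ⟨d, b, hd, hb, hbS⟩ := exists_homogeneous_notMem 𝒜
      (hfin.toFinset.filter fun q => ¬ (irrelevant 𝒜).toIdeal ≤ q)
      (fun q hq => by
        rw [Finset.mem_filter, Set.Finite.mem_toFinset] at hq
        exact ⟨hq.1.1.1, isHomogeneous_of_mem_minimalPrimes 𝒜 hJa hq.1, hq.2⟩)
      (fun p hp q hq hqp => by
        rw [Finset.mem_filter, Set.Finite.mem_toFinset] at hp hq
        exact le_antisymm hqp (hp.1.2 hq.1.1 hqp))
    refine ⟨Fin.snoc a b, fun j => ?_, fun p hpa hpi => ?_⟩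
    · induction j using Fin.lastCases with
      | last => exact ⟨d, hd, by simpa using hb⟩
      | cast j => simpa using ha j
    · have hle : Ideal.span (Set.range a) ≤ p.1.asIdeal := by
        refine Ideal.span_le.2 ?_
        rintro _ ⟨j, rfl⟩
        exact hpa (Ideal.subset_span ⟨j.castSucc, by simp⟩)
      have hbp : b ∈ p.1.asIdeal := hpa (Ideal.subset_span ⟨Fin.last i, by simp⟩)
      have := p.1.isPrime
      obtain ⟨q, hq, hqp⟩ := Ideal.exists_minimalPrimes_le (sup_le p.2 hle)
      have hqi : ¬ (irrelevant 𝒜).toIdeal ≤ q := fun h => hpi (h.trans hqp)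
      have hbq := hbS q (by
        rw [Finset.mem_filter, Set.Finite.mem_toFinset]
        exact ⟨hq, hqi⟩)
      have hqJ : (⟨q, hq.1.1⟩ : PrimeSpectrum A) ∈ PrimeSpectrum.zeroLocus (J : Set A) :=
        le_sup_left.trans hq.1.2
      have h1 := hp ⟨⟨q, hq.1.1⟩, hqJ⟩ (le_sup_right.trans hq.1.2) hqi
      have hlt : (⟨⟨q, hq.1.1⟩, hqJ⟩ : PrimeSpectrum.zeroLocus (J : Set A)) < p :=
        lt_of_le_of_ne hqp fun h => hbq (by rw [← h] at hbp; exact hbp)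
      push_cast
      exact (add_le_add_left h1 1).trans (Order.height_add_one_le hlt)

/-- A homogeneous system of parameters modulo a homogeneous ideal. -/
theorem exists_irrelevant_le_radical [IsNoetherianRing A] {J : Ideal A}
    (hJ : J.IsHomogeneous 𝒜) (l : ℕ) (hl : ringKrullDim (A ⧸ J) ≤ l) :
    ∃ a : Fin l → A, (∀ j, ∃ d, 0 < d ∧ a j ∈ 𝒜 d) ∧
      (irrelevant 𝒜).toIdeal ≤ (J ⊔ Ideal.span (Set.range a)).radical := by
  obtain ⟨a, ha, hp⟩ := exists_homogeneous_sequence_height 𝒜 hJ l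
  refine ⟨a, ha, ?_⟩
  have hJa : (J ⊔ Ideal.span (Set.range a)).IsHomogeneous 𝒜 := by
    refine hJ.sup (Ideal.homogeneous_span 𝒜 _ ?_)
    rintro _ ⟨j, rfl⟩
    obtain ⟨d, -, hd⟩ := ha j
    exact ⟨d, hd⟩
  -- The radical is an intersection of homogeneous primes `q`. One missing part of the irrelevant
  -- ideal would have height at least `l` and a prime strictly above it, so the dimension would
  -- exceed `l`.
  rw [hJa.radical_eq]
  refine le_sInf fun q ⟨hqh, hq, hqp⟩ => ?_
  by_contra hqi
  obtain ⟨r, hr, hqr⟩ := exists_isPrime_gt 𝒜 hqp hqh hqi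
  have hqJ : (⟨q, hqp⟩ : PrimeSpectrum A) ∈ PrimeSpectrum.zeroLocus (J : Set A) :=
    le_sup_left.trans hq
  have hrJ : (⟨r, hr⟩ : PrimeSpectrum A) ∈ PrimeSpectrum.zeroLocus (J : Set A) :=
    (le_sup_left.trans hq).trans hqr.le
  have h1 := hp ⟨⟨q, hqp⟩, hqJ⟩ (le_sup_right.trans hq) hqi
  have hlt : (⟨⟨q, hqp⟩, hqJ⟩ : PrimeSpectrum.zeroLocus (J : Set A)) < ⟨⟨r, hr⟩, hrJ⟩ := hqr
  have h2 := (add_le_add_left h1 1).trans (Order.height_add_one_le hlt)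
  have h3 := (WithBot.coe_le_coe.2 h2).trans (Order.height_le_krullDim _)
  rw [← ringKrullDim_quotient] at h3
  have h4 := h3.trans hl
  have h5 : ((l : ℕ∞) + 1) ≤ l := WithBot.coe_le_coe.1 h4
  norm_cast at h5
  omega

end Graded
end ModuleDivisors

noncomputable section

namespace ModuleDivisors
-- Grading of the Rees algebra of an ideal and dimension of its special fiber
section Rees

open Polynomial HomogeneousIdeal

variable {R : Type*} [CommRing R] (I : Ideal R)

/-- The degree `n` component `Iⁿ tⁿ` of the Rees algebra of an ideal. -/
def reesGrading (n : ℕ) : Submodule R (reesAlgebra I) :=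
  (LinearMap.range (monomial n : R →ₗ[R] R[X])).comap (reesAlgebra I).val.toLinearMap

variable {I}

theorem mem_reesGrading {n : ℕ} {f : reesAlgebra I} :
    f ∈ reesGrading I n ↔ ∃ r, monomial n r = (f : R[X]) := Iff.rfl

theorem coeff_of_mem_reesGrading {n i : ℕ} {f : reesAlgebra I} (hf : f ∈ reesGrading I n)
    (h : n ≠ i) : (f : R[X]).coeff i = 0 := by
  obtain ⟨r, hr⟩ := hf
  change monomial n r = (f : R[X]) at hr
  rw [← hr, coeff_monomial, if_neg h]

/-- The degree `n` component of an element of the Rees algebra. -/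
def reesComponent (f : reesAlgebra I) (n : ℕ) : reesGrading I n :=
  ⟨⟨monomial n ((f : R[X]).coeff n), reesAlgebra.monomial_mem.2 (f.2 n)⟩, ⟨_, rfl⟩⟩

instance reesGradedMonoid : SetLike.GradedMonoid (reesGrading I) where
  one_mem := ⟨1, rfl⟩
  mul_mem i j f g := by
    rintro ⟨r, hr⟩ ⟨s, hs⟩
    refine ⟨r * s, ?_⟩
    change monomial i r = (f : R[X]) at hr
    change monomial j s = (g : R[X]) at hs
    change monomial (i + j) (r * s) = (f : R[X]) * (g : R[X])
    rw [← hr, ← hs, monomial_mul_monomial]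

theorem coe_coeAddMonoidHom_coeff (x : DirectSum ℕ fun i => reesGrading I i) (i : ℕ) :
    ((DirectSum.coeAddMonoidHom (reesGrading I) x : reesAlgebra I) : R[X]).coeff i =
      ((x i : reesAlgebra I) : R[X]).coeff i := by
  classical
  induction x using DirectSum.induction_on with
  | zero => simp
  | of n y =>
    rw [DirectSum.coeAddMonoidHom_of]
    by_cases h : n = i
    · subst h; rw [DirectSum.of_eq_same]
    · rw [DirectSum.of_eq_of_ne _ _ _ (Ne.symm h), coeff_of_mem_reesGrading y.2 h]; simp
  | add x y hx hy => simp [hx, hy]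

instance reesGradedRing : GradedRing (reesGrading I) where
  toGradedMonoid := reesGradedMonoid
  decompose' f := DirectSum.mk _ (f : R[X]).support fun n => reesComponent f n
  left_inv f := by
    classical
    ext i
    rw [coe_coeAddMonoidHom_coeff]
    by_cases h : i ∈ (f : R[X]).support
    · rw [DirectSum.mk_apply_of_mem h]
      simp [reesComponent]
    · rw [DirectSum.mk_apply_of_notMem h]
      simpa using (notMem_support_iff.1 h).symm
  right_inv x := by
    classical
    ext i j
    set f := DirectSum.coeAddMonoidHom (reesGrading I) x
    have hfi : ∀ i, (f : R[X]).coeff i = ((x i : reesAlgebra I) : R[X]).coeff i :=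
      coe_coeAddMonoidHom_coeff x
    have hx : ((x i : reesAlgebra I) : R[X]).coeff j = (monomial i ((f : R[X]).coeff i)).coeff j := by
      rw [coeff_monomial]
      split_ifs with h
      · subst h; exact (hfi i).symm
      · exact coeff_of_mem_reesGrading (x i).2 h
    rw [hx]
    by_cases h : i ∈ (f : R[X]).support
    · rw [DirectSum.mk_apply_of_mem h]
      simp [reesComponent]
    · rw [DirectSum.mk_apply_of_notMem h, notMem_support_iff.1 h]
      simp

theorem exists_mem_irrelevant_pow_eq_monomial {n : ℕ} {r : R} (hr : r ∈ I ^ n) :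
    ∃ x ∈ (irrelevant (reesGrading I)).toIdeal ^ n, (x : R[X]) = monomial n r := by
  induction n generalizing r with
  | zero => exact ⟨⟨monomial 0 r, reesAlgebra.monomial_mem.2 hr⟩, by simp, rfl⟩
  | succ n ih =>
    rw [pow_succ'] at hr
    refine Submodule.smul_induction_on hr ?_ ?_
    · intro a ha b hb
      obtain ⟨x, hx, hxb⟩ := ih hb
      have h1 : (⟨monomial 1 a, reesAlgebra.monomial_mem.2 (by rwa [pow_one])⟩ : reesAlgebra I) ∈
          (irrelevant (reesGrading I)).toIdeal :=
        mem_irrelevant_of_mem _ one_pos ⟨a, rfl⟩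
      refine ⟨_, by rw [pow_succ']; exact Ideal.mul_mem_mul h1 hx, ?_⟩
      rw [MulMemClass.coe_mul, hxb, monomial_mul_monomial, add_comm, smul_eq_mul]
    · rintro a b ⟨x, hx, hxa⟩ ⟨y, hy, hyb⟩
      exact ⟨x + y, add_mem hx hy, by rw [map_add, ← hxa, ← hyb]; rfl⟩

theorem _root_.Ideal.height_radical_eq {S : Type*} [CommRing S] (K : Ideal S) :
    K.radical.height = K.height := by
  rw [Ideal.height_eq_inf_minimalPrimes, Ideal.height_eq_inf_minimalPrimes,
    Ideal.radical_minimalPrimes]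

theorem coeff_mem_of_mem_map {J : Ideal R} {f : reesAlgebra I}
    (hf : f ∈ J.map (algebraMap R (reesAlgebra I))) (n : ℕ) : (f : R[X]).coeff n ∈ J * I ^ n := by
  have h : f ∈ J • (⊤ : Submodule R (reesAlgebra I)) := by
    rwa [Ideal.smul_top_eq_map, Submodule.restrictScalars_mem]
  refine Submodule.smul_induction_on (p := fun f : reesAlgebra I => (f : R[X]).coeff n ∈ J * I ^ n)
    h ?_ ?_
  · intro r hr g _
    rw [SetLike.val_smul, coeff_smul]
    exact Ideal.mul_mem_mul hr (g.2 n)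
  · intro x y hx hy
    rw [AddMemClass.coe_add, coeff_add]
    exact add_mem hx hy

theorem coeff_mem_of_mem_span {ι : Type*} {a : ι → reesAlgebra I} {b : ι → R} {d : ι → ℕ}
    (hab : ∀ j, (a j : R[X]) = monomial (d j) (b j)) {f : reesAlgebra I}
    (hf : f ∈ Ideal.span (Set.range a)) (n : ℕ) :
    (f : R[X]).coeff n ∈ Ideal.span (Set.range b) := by
  suffices f ∈ Ideal.comap (reesAlgebra I).val.toRingHom
      (Ideal.map (C : R →+* R[X]) (Ideal.span (Set.range b))) from
    Ideal.mem_map_C_iff.1 this n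
  refine (Ideal.span_le.2 ?_) hf
  rintro _ ⟨j, rfl⟩
  change (a j : R[X]) ∈ Ideal.map (C : R →+* R[X]) (Ideal.span (Set.range b))
  rw [hab, ← C_mul_X_pow_eq_monomial]
  exact Ideal.mul_mem_right _ _ (Ideal.mem_map_of_mem _ (Ideal.subset_span ⟨j, rfl⟩))

variable [IsLocalRing R] [IsNoetherianRing R]

/-- The Krull dimension of the special fiber of the Rees algebra of a proper ideal is at least the
height of the ideal. -/
theorem height_le_ringKrullDim_reesAlgebra_quotient (hI : I ≠ ⊤) :
    (I.height : WithBot ℕ∞) ≤ ringKrullDim (reesAlgebra I ⧸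
      (IsLocalRing.maximalIdeal R).map (algebraMap R (reesAlgebra I))) := by
  set J := (IsLocalRing.maximalIdeal R).map (algebraMap R (reesAlgebra I))
  have hJtop : J ≠ ⊤ := by
    intro h
    have h1 := coeff_mem_of_mem_map (J := IsLocalRing.maximalIdeal R)
      ((Ideal.eq_top_iff_one J).1 h) 0
    rw [pow_zero, mul_one, OneMemClass.coe_one, coeff_one_zero] at h1
    exact (Ideal.ne_top_iff_one _).1 (IsLocalRing.maximalIdeal.isMaximal R).ne_top h1
  have : Nontrivial (reesAlgebra I ⧸ J) := Ideal.Quotient.nontrivial_iff.2 hJtop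
  have hJh : J.IsHomogeneous (reesGrading I) := by
    refine Ideal.homogeneous_span _ _ ?_
    rintro _ ⟨r, -, rfl⟩
    exact ⟨0, ⟨r, rfl⟩⟩
  by_cases htop : ringKrullDim (reesAlgebra I ⧸ J) = ⊤
  · rw [htop]; exact le_top
  obtain ⟨l, hl⟩ : ∃ l : ℕ, ringKrullDim (reesAlgebra I ⧸ J) = l := by
    have h0 : ringKrullDim (reesAlgebra I ⧸ J) ≠ ⊥ := fun h => by
      simpa [h] using ringKrullDim_nonneg_of_nontrivial (R := reesAlgebra I ⧸ J)
    obtain ⟨m, hm⟩ := WithBot.ne_bot_iff_exists.1 h0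
    rw [← hm] at htop ⊢
    obtain ⟨l, rfl⟩ := ENat.ne_top_iff_exists.1 (fun h : m = ⊤ => htop (by rw [h]; rfl))
    exact ⟨l, rfl⟩
  obtain ⟨a, ha, hrad⟩ := exists_irrelevant_le_radical (reesGrading I) hJh l hl.le
  choose d hd hda using ha
  choose b hb using fun j => mem_reesGrading.1 (hda j)
  obtain ⟨n, hn⟩ := Ideal.exists_pow_le_of_le_radical_of_fg hrad (IsNoetherian.noetherian _)
  -- Compare coefficients of `tⁿ` in `r tⁿ = y + z`, where `y` lies in the extension of `𝔪` and `z`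
  -- in the ideal of the parameters.
  have hle : I ^ n ≤ Ideal.span (Set.range b) ⊔ IsLocalRing.maximalIdeal R • I ^ n := by
    intro r hr
    obtain ⟨x, hx, hxr⟩ := exists_mem_irrelevant_pow_eq_monomial hr
    obtain ⟨y, hy, z, hz, rfl⟩ := Submodule.mem_sup.1 (hn hx)
    have h1 := coeff_mem_of_mem_map hy n
    have h2 := coeff_mem_of_mem_span (fun j => (hb j).symm) hz n
    have h3 : r = (y : R[X]).coeff n + (z : R[X]).coeff n := by
      rw [← coeff_add, ← AddMemClass.coe_add, hxr, coeff_monomial_same]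
    rw [h3, add_comm]
    exact Submodule.add_mem_sup h2 h1
  have hle' : I ^ n ≤ Ideal.span (Set.range b) :=
    Submodule.le_of_le_smul_of_le_jacobson_bot (IsNoetherian.noetherian _)
      (IsLocalRing.maximalIdeal_le_jacobson _) hle
  have hbI : Ideal.span (Set.range b) ≤ I := by
    refine Ideal.span_le.2 ?_
    rintro _ ⟨j, rfl⟩
    have := (a j).2 (d j)
    rw [← hb, coeff_monomial_same] at this
    -- Positivity of the degrees is what places the coefficients in `I`.
    exact Ideal.pow_le_self (hd j).ne' this
  have hbtop : Ideal.span (Set.range b) ≠ ⊤ := fun h => hI (top_le_iff.1 (h ▸ hbI))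
  have h1 : I ≤ (Ideal.span (Set.range b)).radical := fun x hx => ⟨n, hle' (Ideal.pow_mem_pow hx n)⟩
  rw [hl]
  refine WithBot.coe_le_coe.2 (?_ : I.height ≤ l)
  calc I.height ≤ (Ideal.span (Set.range b)).radical.height := Ideal.height_mono h1
    _ = (Ideal.span (Set.range b)).height := Ideal.height_radical_eq _
    _ ≤ _ := Ideal.height_le_spanFinrank _ hbtop
    _ ≤ l := by
      refine Nat.cast_le.2 ((Submodule.spanFinrank_span_le_ncard_of_finite (Set.finite_range b)).trans ?_)
      rw [← Set.image_univ]
      simpa using Set.ncard_image_le (f := b) Set.finite_univ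

end Rees
end ModuleDivisors
end

noncomputable section
namespace ModuleDivisors
-- Linear forms and analytic spread
section AnalyticSpread

open Polynomial

variable {R M : Type*} [CommRing R] [AddCommGroup M] [Module R M]

/-- The map `m ↦ φ(m) t` to the Rees algebra of the image of a linear form `φ`. -/
def toReesAlgebra (φ : M →ₗ[R] R) : M →ₗ[R] reesAlgebra (LinearMap.range φ) where
  toFun m := ⟨monomial 1 (φ m), reesAlgebra.monomial_mem.2 (by rw [pow_one]; exact ⟨m, rfl⟩)⟩
  map_add' x y := Subtype.ext (by simp)
  map_smul' r x := Subtype.ext (by simp [smul_monomial])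

theorem lift_toReesAlgebra_surjective (φ : M →ₗ[R] R) :
    Function.Surjective (SymmetricAlgebra.lift (toReesAlgebra φ)) := by
  rw [← AlgHom.range_eq_top, eq_top_iff]
  rintro ⟨f, hf⟩ -
  have hle : reesAlgebra (LinearMap.range φ) ≤
      (SymmetricAlgebra.lift (toReesAlgebra φ)).range.map (reesAlgebra (LinearMap.range φ)).val := by
    refine (adjoin_monomial_eq_reesAlgebra _).ge.trans (Algebra.adjoin_le ?_)
    rintro _ ⟨_, ⟨m, rfl⟩, rfl⟩
    exact ⟨_, ⟨SymmetricAlgebra.ι R M m, rfl⟩, by simp [toReesAlgebra]⟩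
  obtain ⟨g, hg, hgf⟩ := hle hf
  have : g = ⟨f, hf⟩ := Subtype.ext hgf
  rwa [← this]

theorem eq_zero_of_mem_torsion {I : Ideal R} {f : reesAlgebra I}
    (hf : f ∈ Submodule.torsion R (reesAlgebra I)) : f = 0 := by
  obtain ⟨a, ha⟩ := hf
  ext n
  have h1 : (a : R) * (f : R[X]).coeff n = 0 := by
    have := congrArg (fun g : reesAlgebra I => (g : R[X]).coeff n) ha
    simpa [Submonoid.smul_def] using this
  simpa using (mem_nonZeroDivisors_iff.1 a.2).1 _ h1

/-- The Rees algebra of a module surjects onto the Rees algebra of the image of a linear form. -/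
def reesAlgToReesAlgebra (φ : M →ₗ[R] R) : ReesAlg R M →ₐ[R] reesAlgebra (LinearMap.range φ) :=
  Ideal.Quotient.liftₐ _ (SymmetricAlgebra.lift (toReesAlgebra φ)) fun x hx => by
    obtain ⟨a, ha⟩ : x ∈ Submodule.torsion R (SymmetricAlgebra R M) := hx
    refine eq_zero_of_mem_torsion ⟨a, ?_⟩
    rw [Submonoid.smul_def] at ha ⊢
    rw [← map_smul, ha, map_zero]

theorem reesAlgToReesAlgebra_surjective (φ : M →ₗ[R] R) :
    Function.Surjective (reesAlgToReesAlgebra φ) :=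
  Ideal.Quotient.lift_surjective_of_surjective _ _ (lift_toReesAlgebra_surjective φ)

theorem exists_fiberCone_surjective [IsLocalRing R] (φ : M →ₗ[R] R) :
    ∃ g : FiberCone R M →+* (reesAlgebra (LinearMap.range φ) ⧸
      (IsLocalRing.maximalIdeal R).map (algebraMap R (reesAlgebra (LinearMap.range φ)))),
      Function.Surjective g := by
  let T := reesAlgebra (LinearMap.range φ)
  let J := (IsLocalRing.maximalIdeal R).map (algebraMap R T)
  let g₁ : ReesAlg R M →ₐ[R] T ⧸ J := (Ideal.Quotient.mkₐ R J).comp (reesAlgToReesAlgebra φ)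
  let g₂ : IsLocalRing.ResidueField R →ₐ[R] T ⧸ J :=
    Ideal.Quotient.liftₐ _ (Algebra.ofId R (T ⧸ J)) fun r hr => by
      rw [Algebra.ofId_apply, IsScalarTower.algebraMap_apply R T (T ⧸ J)]
      exact Ideal.Quotient.eq_zero_iff_mem.2 (Ideal.mem_map_of_mem _ hr)
  let g := Algebra.TensorProduct.lift g₁ g₂ fun x y => (mul_comm (g₁ x) (g₂ y) : g₁ x * g₂ y = g₂ y * g₁ x)
  refine ⟨g.toRingHom, fun y => ?_⟩
  obtain ⟨t, rfl⟩ := Ideal.Quotient.mk_surjective y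
  obtain ⟨x, rfl⟩ := reesAlgToReesAlgebra_surjective φ t
  refine ⟨x ⊗ₜ 1, (Algebra.TensorProduct.lift_tmul g₁ g₂ _ x 1).trans ?_⟩
  rw [map_one, mul_one]
  rfl

theorem height_range_le_analyticSpread [IsLocalRing R] [IsNoetherianRing R] (φ : M →ₗ[R] R)
    (hφ : LinearMap.range φ ≠ ⊤) :
    (Ideal.height (LinearMap.range φ) : WithBot ℕ∞) ≤ analyticSpread R M := by
  obtain ⟨g, hg⟩ := exists_fiberCone_surjective φ
  exact (height_le_ringKrullDim_reesAlgebra_quotient hφ).trans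
    (ringKrullDim_le_of_surjective g hg)

end AnalyticSpread

/-! ### The determinant form on the top exterior power -/

section Determinants

variable {R E : Type*} [CommRing R] [AddCommGroup E] [Module R E] {e : ℕ}

/-- The determinantal linear form on the top exterior power induced by a map to `R ^ e`. -/
def detForm (f : E →ₗ[R] (Fin e → R)) : (⋀[R]^e E) →ₗ[R] R :=
  exteriorPower.alternatingMapLinearEquiv (Matrix.detRowAlternating.compLinearMap f)

theorem detForm_ιMulti (f : E →ₗ[R] (Fin e → R)) (v : Fin e → E) :
    detForm f (exteriorPower.ιMulti R e v) = (Matrix.of fun i => f (v i)).det := by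
  rw [detForm, exteriorPower.alternatingMapLinearEquiv_apply_ιMulti]
  rfl

theorem det_mem_range_detForm (f : E →ₗ[R] (Fin e → R)) (v : Fin e → E) :
    (Matrix.of fun i => f (v i)).det ∈ LinearMap.range (detForm f) :=
  ⟨_, detForm_ιMulti f v⟩

/-- Over a local ring some generating determinant must be a unit; the corresponding images then span
`R ^ e`, so `f` is an isomorphism. -/
theorem free_of_range_detForm_eq_top [IsLocalRing R] {f : E →ₗ[R] (Fin e → R)}
    (hf : Function.Injective f) (h : LinearMap.range (detForm f) = ⊤) : Module.Free R E := by
  obtain ⟨v, hv⟩ : ∃ v : Fin e → E, IsUnit (Matrix.of fun i => f (v i)).det := by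
    by_contra! H
    have hle : LinearMap.range (detForm f) ≤ IsLocalRing.maximalIdeal R := by
      rw [LinearMap.range_eq_map, ← exteriorPower.ιMulti_span, Submodule.map_span,
        Submodule.span_le]
      rintro _ ⟨_, ⟨v, rfl⟩, rfl⟩
      rw [detForm_ιMulti]
      exact H v
    exact (IsLocalRing.maximalIdeal.isMaximal R).ne_top (top_le_iff.1 (h ▸ hle))
  have hsurj : Function.Surjective f := by
    intro w
    refine ⟨∑ i, (Matrix.vecMul w (Matrix.of fun i => f (v i))⁻¹) i • v i, ?_⟩
    rw [map_sum]
    simp_rw [map_smul]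
    have h1 : Matrix.vecMul (Matrix.vecMul w (Matrix.of fun i => f (v i))⁻¹)
        (Matrix.of fun i => f (v i)) = w := by
      rw [Matrix.vecMul_vecMul, Matrix.nonsing_inv_mul _ hv, Matrix.vecMul_one]
    rw [Matrix.vecMul_eq_sum] at h1
    exact h1
  exact Module.Free.of_equiv (LinearEquiv.ofBijective f ⟨hf, hsurj⟩).symm

/-- If `x R ^ e` lies in the span of the images of `y`, then `x ^ e` is a multiple of their
determinant. -/
theorem det_dvd_pow {f : E →ₗ[R] (Fin e → R)} {y : Fin e → E} {x : R}
    (h : ∀ w : Fin e → R, ∃ z ∈ Submodule.span R (Set.range y), f z = x • w) :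
    (Matrix.of fun i => f (y i)).det ∣ x ^ e := by
  have h1 : ∀ i, ∃ c : Fin e → R, ∑ k, c k • f (y k) = x • (Pi.single i 1 : Fin e → R) := by
    intro i
    obtain ⟨z, hz, hzx⟩ := h (Pi.single i 1)
    obtain ⟨c, rfl⟩ := (Submodule.mem_span_range_iff_exists_fun R).1 hz
    exact ⟨c, by rw [← hzx, map_sum]; simp_rw [map_smul]⟩
  choose c hc using h1
  have h2 : Matrix.of c * Matrix.of (fun i => f (y i)) = x • (1 : Matrix (Fin e) (Fin e) R) := by
    ext i j
    have := congrFun (hc i) j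
    simp only [Finset.sum_apply, Pi.smul_apply, smul_eq_mul] at this
    rw [Matrix.mul_apply]
    simp only [Matrix.of_apply, Matrix.smul_apply, smul_eq_mul, this, Matrix.one_apply,
      Pi.single_apply, eq_comm]
  refine ⟨(Matrix.of c).det, ?_⟩
  rw [mul_comm, ← Matrix.det_mul, h2, Matrix.det_smul, Matrix.det_one, mul_one, Fintype.card_fin]

theorem pow_mem_range_detForm {f : E →ₗ[R] (Fin e → R)} {x : R}
    (h : ∀ w : Fin e → R, x • w ∈ LinearMap.range f) : x ^ e ∈ LinearMap.range (detForm f) := by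
  choose v hv using fun i => h (Pi.single i 1)
  convert det_mem_range_detForm f v
  have : (Matrix.of fun i => f (v i)) = x • (1 : Matrix (Fin e) (Fin e) R) := by
    ext i j
    simp [hv, Matrix.one_apply, Pi.single_apply, eq_comm]
  rw [this, Matrix.det_smul, Matrix.det_one, mul_one, Fintype.card_fin]

end Determinants

/-! ### Elements of Fitting ideals as multipliers -/

section Fitting

variable {R M : Type*} [CommRing R] [AddCommGroup M] [Module R M]

theorem IsPresentation.sum_smul_eq_zero {n m : ℕ} {A : Matrix (Fin n) (Fin m) R} {x : Fin n → M}
    (h : IsPresentation A x) (j : Fin m) : ∑ i, A i j • x i = 0 := by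
  have h1 : A.mulVecLin (Pi.single j 1) ∈ LinearMap.ker (Fintype.linearCombination R x) :=
    h.range_eq_ker ▸ ⟨_, rfl⟩
  simpa [Fintype.linearCombination_apply] using h1

/-- Cramer's rule: modulo the generators outside the chosen rows, the chosen columns are relations
with square matrix `S`, and the adjugate shows that `S.det` kills the remaining generators. -/
theorem IsPresentation.det_smul_mem_span {n m t : ℕ} {A : Matrix (Fin n) (Fin m) R} {x : Fin n → M}
    (h : IsPresentation A x) (r : Fin t ↪o Fin n) (c : Fin t ↪o Fin m) (z : M) :
    (A.submatrix r c).det • z ∈ Submodule.span R (x '' (Set.range r)ᶜ) := by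
  classical
  set N := Submodule.span R (x '' (Set.range r)ᶜ)
  set S := A.submatrix r c
  have hcol : ∀ j, ∑ k, S k j • x (r k) ∈ N := by
    intro j
    have h1 := h.sum_smul_eq_zero (c j)
    rw [← Finset.sum_add_sum_compl (Finset.univ.map r.toEmbedding), Finset.sum_map] at h1
    change ∑ k, S k j • x (r k) + _ = 0 at h1
    rw [eq_neg_of_add_eq_zero_left h1]
    refine neg_mem (Submodule.sum_mem _ fun i hi => Submodule.smul_mem _ _
      (Submodule.subset_span ⟨i, ?_, rfl⟩))
    simpa using hi
  have hx : ∀ i, S.det • x i ∈ N := by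
    intro i
    by_cases hi : i ∈ Set.range r
    · obtain ⟨k, rfl⟩ := hi
      have h2 : S.det • x (r k) = ∑ j, S.adjugate j k • ∑ k', S k' j • x (r k') := by
        simp_rw [Finset.smul_sum, smul_smul]
        rw [Finset.sum_comm]
        simp_rw [← Finset.sum_smul]
        have h3 : ∀ k', ∑ j, S.adjugate j k * S k' j = (S.det • (1 : Matrix (Fin t) (Fin t) R)) k' k := by
          intro k'
          rw [← Matrix.mul_adjugate, Matrix.mul_apply]
          exact Finset.sum_congr rfl fun j _ => mul_comm _ _
        simp [h3, Matrix.one_apply]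
      rw [h2]
      exact Submodule.sum_mem _ fun j _ => Submodule.smul_mem _ _ (hcol j)
    · exact Submodule.smul_mem _ _ (Submodule.subset_span ⟨i, hi, rfl⟩)
  have hz : z ∈ Submodule.span R (Set.range x) := h.span_eq_top ▸ Submodule.mem_top
  obtain ⟨a, rfl⟩ := (Submodule.mem_span_range_iff_exists_fun R).1 hz
  rw [Finset.smul_sum]
  refine Submodule.sum_mem _ fun i _ => ?_
  rw [smul_comm]
  exact Submodule.smul_mem _ _ (hx i)

theorem exists_subset_range_of_ncard_le {s : Set M} (hs : s.Finite) {i : ℕ}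
    (h : s.ncard ≤ i) : ∃ y : Fin i → M, s ⊆ Set.range y := by
  classical
  obtain ⟨t, rfl⟩ := hs.exists_finset_coe
  rw [Set.ncard_coe_finset] at h
  refine ⟨fun j => if hj : j.1 < t.card then (t.equivFin.symm ⟨j, hj⟩ : M) else 0, fun x hx => ?_⟩
  refine ⟨⟨t.equivFin ⟨x, hx⟩, (Fin.is_lt _).trans_le h⟩, ?_⟩
  simp

/-- The `i`-th Fitting ideal lies in every ideal containing all elements that multiply the module
into a submodule with `i` generators. -/
theorem fittingIdeal_le {i : ℕ} {K : Ideal R}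
    (h : ∀ (a : R) (y : Fin i → M), (∀ z, a • z ∈ Submodule.span R (Set.range y)) → a ∈ K) :
    fittingIdeal R M i ≤ K := by
  refine iSup_le fun n => iSup_le fun m => iSup_le fun A => iSup_le fun x => iSup_le fun hA => ?_
  refine Ideal.span_le.2 ?_
  rintro _ ⟨r, c, rfl⟩
  -- The bound `n - (n - i) ≤ i` also holds for `n < i` with truncated subtraction; the list of
  -- generators is then padded with zeros.
  have hcard : (x '' (Set.range r)ᶜ).ncard ≤ i := by
    refine (Set.ncard_image_le (Set.toFinite _)).trans ?_
    rw [Set.ncard_compl, ← Set.image_univ, Set.ncard_image_of_injective _ r.injective]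
    simp only [Nat.card_eq_fintype_card, Fintype.card_fin, Set.ncard_univ]
    omega
  obtain ⟨y, hy⟩ := exists_subset_range_of_ncard_le (Set.toFinite _) hcard
  exact h _ y fun z => Submodule.span_mono hy (hA.det_smul_mem_span r c z)

end Fitting
end ModuleDivisors
end

namespace ModuleDivisors
-- Grade two and the Fitting ideal inclusions
section Grade

variable {R : Type*} [CommRing R]

/-- If `x, y` is weakly regular, so is `x ^ k, y ^ j`: factors of `x` are split off one at a time,
then factors of `y` are cancelled. -/
theorem pow_dvd_of_pow_dvd_mul {x y : R} (hx : IsSMulRegular R x)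
    (hy : ∀ a, x ∣ y * a → x ∣ a) (j k : ℕ) {a : R} (h : x ^ k ∣ y ^ j * a) : x ^ k ∣ a := by
  have h1 : ∀ (k : ℕ) (a : R), x ^ k ∣ y * a → x ^ k ∣ a := by
    intro k
    induction k with
    | zero => simp
    | succ k ih =>
      rintro a ⟨b, hb⟩
      obtain ⟨a', rfl⟩ := hy a ⟨x ^ k * b, by rw [hb]; ring⟩
      have h2 : y * a' = x ^ k * b := hx (by simp only [smul_eq_mul]; linear_combination hb)
      rw [pow_succ']
      exact mul_dvd_mul_left x (ih a' ⟨b, h2⟩)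
  induction j with
  | zero => simpa using h
  | succ j ih => exact ih (h1 k _ (by rwa [pow_succ', mul_assoc] at h))

theorem exists_regular_pair_of_two_le_moduleGrade {M : Type*} [AddCommGroup M] [Module R M]
    (h : 2 ≤ moduleGrade R M) : ∃ x ∈ Module.annihilator R M, ∃ y ∈ Module.annihilator R M,
      IsSMulRegular R x ∧ ∀ a, x ∣ y * a → x ∣ a := by
  by_contra! H
  have hle : moduleGrade R M ≤ 1 := by
    refine iSup_le fun rs => iSup_le fun ⟨hann, hreg⟩ => ?_
    match rs, hann, hreg with
    | [], _, _ => simp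
    | [_], _, _ => simp
    | x :: y :: rs, hann, hreg =>
      exfalso
      rw [RingTheory.Sequence.isWeaklyRegular_cons_iff,
        RingTheory.Sequence.isWeaklyRegular_cons_iff] at hreg
      obtain ⟨a, ha, hna⟩ := H x (hann x (by simp)) y (hann y (by simp)) hreg.1
      refine hna ?_
      have hmem : ∀ b : R, (Submodule.Quotient.mk b : QuotSMulTop x R) = 0 ↔ x ∣ b := by
        intro b
        rw [Submodule.Quotient.mk_eq_zero, Submodule.mem_smul_pointwise_iff_exists]
        simp [dvd_def, eq_comm]
      rw [← hmem]
      refine hreg.2.1 ?_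
      simp only [smul_zero]
      rw [← Submodule.Quotient.mk_smul, hmem]
      exact ha
  exact absurd (h.trans hle) (by norm_num)

variable {E : Type*} [AddCommGroup E] [Module R E]

/-- The cokernel of `f` is killed by the non-zero-divisor `x`, so `f` becomes an isomorphism over
the total ring of fractions, where ranks can be compared. -/
theorem eq_of_hasRank [Nontrivial R] {e n : ℕ} (hE : HasRank R E e) {f : E →ₗ[R] (Fin n → R)}
    (hf : Function.Injective f) {x : R} (hx : IsSMulRegular R x)
    (hxf : ∀ w, x • w ∈ LinearMap.range f) : e = n := by
  obtain ⟨φ⟩ := hE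
  have hx0 : x ∈ nonZeroDivisors R := by
    rw [mem_nonZeroDivisors_iff_right]
    intro a ha
    exact hx (by simpa [mul_comm] using ha)
  have hinj : Function.Injective (f.baseChange (FractionRing R)) :=
    Module.Flat.lTensor_preserves_injective_linearMap f hf
  have hsurj : Function.Surjective (f.baseChange (FractionRing R)) := by
    intro t
    induction t using TensorProduct.induction_on with
    | zero => exact ⟨0, map_zero _⟩
    | tmul q w =>
      obtain ⟨z, hz⟩ := hxf w
      -- Here `q ⊗ w = (q / x) ⊗ x w`, and `x w` is in the range of `f`.
      refine ⟨(q * IsLocalization.mk' (FractionRing R) 1 ⟨x, hx0⟩) ⊗ₜ z, ?_⟩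
      rw [LinearMap.baseChange_tmul, hz, ← TensorProduct.smul_tmul, Algebra.smul_def,
        mul_left_comm, IsLocalization.mul_mk'_eq_mk'_of_mul]
      simp
    | add a b ha hb =>
      obtain ⟨a', rfl⟩ := ha
      obtain ⟨b', rfl⟩ := hb
      exact ⟨a' + b', map_add _ _ _⟩
  have ψ := φ.symm.trans ((LinearEquiv.ofBijective _ ⟨hinj, hsurj⟩).trans
    (TensorProduct.piScalarRight R (FractionRing R) (FractionRing R) (Fin n)))
  simpa using ψ.finrank_eq

theorem fittingIdeal_le_radical_range_detForm {e : ℕ} {f : E →ₗ[R] (Fin e → R)} {x y : R}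
    (hx : IsSMulRegular R x) (hxy : ∀ a, x ∣ y * a → x ∣ a)
    (hxf : ∀ w, x • w ∈ LinearMap.range f) (hyf : ∀ w, y • w ∈ LinearMap.range f) :
    fittingIdeal R E e ≤ Ideal.radical (LinearMap.range (detForm f)) := by
  refine fittingIdeal_le fun a v hv => ?_
  have hdvd : ∀ s : R, (∀ w, s • w ∈ LinearMap.range f) →
      (Matrix.of fun i => f (v i)).det ∣ (a * s) ^ e := by
    refine fun s hs => det_dvd_pow fun w => ?_
    obtain ⟨z, hz⟩ := hs w
    exact ⟨a • z, hv z, by rw [map_smul, hz, smul_smul]⟩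
  obtain ⟨c, hc⟩ := hdvd x hxf
  obtain ⟨d, hd⟩ := hdvd y hyf
  set b := (Matrix.of fun i => f (v i)).det
  rw [mul_pow] at hc hd
  -- From `aᵉxᵉ = bc` and `aᵉyᵉ = bd` both `yᵉaᵉc` and `xᵉaᵉd` equal `bcd`, so `xᵉ` divides `aᵉc`.
  -- Multiplying the first relation by `aᵉ` and cancelling `xᵉ` gives `a²ᵉ ∈ (b)`.
  obtain ⟨c', hc'⟩ := pow_dvd_of_pow_dvd_mul (k := e) (a := a ^ e * c) hx hxy e
    ⟨a ^ e * d, by linear_combination c * hd - d * hc⟩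
  have hreg : IsSMulRegular R (x ^ e) := hx.pow e
  have h2 : a ^ (e + e) = b * c' := hreg (by
    simp only [smul_eq_mul]
    rw [pow_add]
    linear_combination a ^ e * hc + b * hc')
  refine ⟨e + e, ?_⟩
  rw [h2]
  exact Ideal.mul_mem_right _ _ (det_mem_range_detForm f v)

theorem fittingIdeal_zero_le_radical_range_detForm {e : ℕ} {G : Type*} [AddCommGroup G]
    [Module R G] (g : G ≃ₗ[R] (Fin e → R)) (E : Submodule R G) :
    fittingIdeal R (G ⧸ E) 0 ≤
      Ideal.radical (LinearMap.range (detForm (g.toLinearMap ∘ₗ E.subtype))) := by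
  refine fittingIdeal_le fun a v hv => ⟨e, pow_mem_range_detForm fun w => ?_⟩
  have h1 := hv (Submodule.Quotient.mk (g.symm w))
  -- A submodule with no generators is zero, so `a` annihilates `G ⧸ E`.
  rw [Set.range_eq_empty, Submodule.span_empty, Submodule.mem_bot, ← Submodule.Quotient.mk_smul,
    Submodule.Quotient.mk_eq_zero] at h1
  exact ⟨⟨_, h1⟩, by simp⟩

theorem height_le_analyticSpread_exteriorPower [IsLocalRing R] [IsNoetherianRing R] {e : ℕ}
    {f : E →ₗ[R] (Fin e → R)} (hf : Function.Injective f) (hfree : ¬ Module.Free R E)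
    {K : Ideal R} (hK : K ≤ Ideal.radical (LinearMap.range (detForm f))) :
    (K.height : WithBot ℕ∞) ≤ analyticSpread R (⋀[R]^e E) :=
  (WithBot.coe_le_coe.2 ((Ideal.height_mono hK).trans (Ideal.height_radical_eq _).le)).trans
    (height_range_le_analyticSpread _ fun h => hfree (free_of_range_detForm_eq_top hf h))

end Grade
end ModuleDivisors

theorem proposition2p3 {R : Type*} [CommRing R] [IsLocalRing R] [IsNoetherianRing R]
    {G : Type*} [AddCommGroup G] [Module R G] (e : ℕ) (he : 0 < e)
    (hG : Nonempty (G ≃ₗ[R] (Fin e → R))) (E : Submodule R G)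
    (hrank : ModuleDivisors.HasRank R E e) (hfree : ¬ Module.Free R E) :
    ((ModuleDivisors.fittingIdeal R (G ⧸ E) 0).height : WithBot ℕ∞) ≤
        ModuleDivisors.analyticSpread R (⋀[R]^e E) ∧
      (ModuleDivisors.IsIdealModule R E →
        ((ModuleDivisors.fittingIdeal R E e).height : WithBot ℕ∞) ≤
          ModuleDivisors.analyticSpread R (⋀[R]^e E)) := by

  obtain ⟨g⟩ := hG
  refine ⟨?_, fun ⟨n, f, hf, hgrade⟩ => ?_⟩
  · exact ModuleDivisors.height_le_analyticSpread_exteriorPower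
      (f := g.toLinearMap ∘ₗ E.subtype) (g.injective.comp E.injective_subtype) hfree
      (ModuleDivisors.fittingIdeal_zero_le_radical_range_detForm g E)
  · obtain ⟨x, hx, y, hy, hreg, hxy⟩ :=
      ModuleDivisors.exists_regular_pair_of_two_le_moduleGrade hgrade
    have hann : ∀ s ∈ Module.annihilator R ((Fin n → R) ⧸ LinearMap.range f), ∀ w,
        s • w ∈ LinearMap.range f := fun s hs w => by
      rw [← Submodule.Quotient.mk_eq_zero, Submodule.Quotient.mk_smul]
      exact Module.mem_annihilator.1 hs _
    -- The embedding witnessing an ideal module may differ from the given one; its target must have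
    -- rank `e` for the determinant form to live on `⋀ᵉE`.
    obtain rfl := ModuleDivisors.eq_of_hasRank hrank hf hreg (hann x hx)
    exact ModuleDivisors.height_le_analyticSpread_exteriorPower hf hfree
      (ModuleDivisors.fittingIdeal_le_radical_range_detForm hreg hxy (hann x hx) (hann y hy))
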